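/- Let $V$ be a finite set and $\Bbbk$ a field. For a simplicial complex $\Delta$ on $V$ (a family of subsets of $V$ closed under taking subsets), let $I_{\mathcal F}(\Delta)\subseteq \Bbbk[x_v : v\in V]$ be its facet ideal, generated by the monomials $\prod_{v\in F}x_v$ for the facets (maximal faces) $F$ of $\Delta$, and let $$\delta_{\mathcal{NF}}(\Delta)=\Bigl\{F\subseteq V : \prod_{v\in F}x_v\notin I_{\mathcal F}(\Delta)\Bigr\}.$$ Two complexes on $V$ are isomorphic ($\cong$) if a permutation of $V$ carries the faces of one exactly onto the faces of the other. The NF-number $\mathcal{NF}(\Delta)$ is the smallest integer $t>0$ such that the $t$-th iterate satisfies $\delta_{\mathcal{NF}}^{(t)}(\Delta)\cong\Delta$. A graph with at least one edge is regarded as the simplicial complex whose facets are its edges. For integers $p,q\ge 1$ let $D_{p,q}$ be the double star: the graph on the $p+q+2$ vertices $u,v,a_1,\dots,a_p,b_1,\dots,b_q$ with edges $\{u,v\}$, $\{u,a_i\}$ $(1\le i\le p)$ and $\{v,b_j\}$ $(1\le j\le q)$. **Theorem.** Let $p,q\ge 1$. 1. If $(p,q)=(1,1)$, then $D_{1,1}$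 is isomorphic to the path $P_4$ on four vertices, and $\mathcal{NF}(D_{1,1})=1$. 2. If $(p,q)\neq(1,1)$, then $\mathcal{NF}(D_{p,q})=p+q+4$. -/

import Mathlib

/-- A simplicial complex on a vertex set `V`: a family of finite subsets of `V` that contains every
subset of each of its members. The empty set may be a face, vertices need not be faces, and the
void family is allowed. -/
abbrev VComplex (V : Type*) := LowerSet (Finset V)

namespace VComplex

variable {V W : Type*}

/-- A facet is a face that is maximal under inclusion. -/
def IsFacet (D : VComplex V) (F : Finset V) : Prop :=
  Maximal (fun G : Finset V => G ∈ D) F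

/-- Two complexes are isomorphic if some bijection of the vertex sets identifies their faces. -/
def Isom (D : VComplex V) (E : VComplex W) : Prop :=
  ∃ π : V ≃ W, ∀ F : Finset V, F ∈ D ↔ F.map π.toEmbedding ∈ E

/-- The squarefree monomial `∏_{v ∈ F} x_v`. -/
noncomputable def faceMonomial (k : Type*) [Field k] (F : Finset V) : MvPolynomial V k :=
  ∏ v ∈ F, MvPolynomial.X v

/-- The facet ideal of a complex, in the polynomial ring over `k` on the vertices. -/
noncomputable def facetIdeal (k : Type*) [Field k] (D : VComplex V) : Ideal (MvPolynomial V k) :=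
  Ideal.span {f | ∃ F : Finset V, D.IsFacet F ∧ f = faceMonomial k F}

/-- The Stanley–Reisner complex of an ideal: the sets `F` with `∏_{v ∈ F} x_v ∉ I`. -/
def stanleyReisner {k : Type*} [Field k] (I : Ideal (MvPolynomial V k)) : VComplex V where
  carrier := {F | faceMonomial k F ∉ I}
  lower' := fun _F _G hGF hF hG =>
    hF (I.mem_of_dvd (Finset.prod_dvd_prod_of_subset _ _ _ hGF) hG)

/-- The NF-operator: the Stanley–Reisner complex of the facet ideal. -/
noncomputable def nf (k : Type*) [Field k] (D : VComplex V) : VComplex V :=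
  stanleyReisner (facetIdeal k D)

/-- `t` is the NF-number of `D`: the least positive integer such that the `t`-th iterate of the
NF-operator at `D` is isomorphic to `D`. -/
def IsNFNumber (k : Type*) [Field k] (D : VComplex V) (t : ℕ) : Prop :=
  IsLeast {n : ℕ | 0 < n ∧ Isom ((nf k)^[n] D) D} t

/-- The simplicial complex of a graph, generated by its edges: a set is a face if it is contained
in an edge. For a graph with at least one edge its dimension is `1`. -/
def ofGraph (G : SimpleGraph V) : VComplex V where
  carrier := {F | ∃ e ∈ G.edgeSet, ∀ x ∈ F, x ∈ e}
  lower' := fun _F _G hGF ⟨e, he, h⟩ => ⟨e, he, fun x hx => h x (hGF hx)⟩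

end VComplex

/-- The vertices `u, v, a_1, …, a_p, b_1, …, b_q` of the double star. -/
inductive DoubleStarVertex (p q : ℕ) : Type
  | u : DoubleStarVertex p q
  | v : DoubleStarVertex p q
  | a : Fin p → DoubleStarVertex p q
  | b : Fin q → DoubleStarVertex p q
  deriving DecidableEq, Fintype

open DoubleStarVertex in
/-- The double star `D_{p,q}`, with the edges `uv`, `u a_i` and `v b_j`. -/
def doubleStar (p q : ℕ) : SimpleGraph (DoubleStarVertex p q) :=
  SimpleGraph.fromEdgeSet
    ({s(u, v)} ∪ Set.range (fun i : Fin p => s(u, a i)) ∪ Set.range (fun j : Fin q => s(v, b j)))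

/-!
The NF-operator is purely combinatorial: a set is a face of `nf D` exactly when it contains no facet
of `D`. Passing to the complements of the facets, called cofacets here, one application of the
operator replaces an antichain `N` by the minimal sets that are not contained in any member of `N`
(`VComplex.IsCofacetFamily.nf`).

Colour the vertices of the double star by its bipartition, and call its two centres `u` and `v` hubs.
The edges are the pairs of a hub and a vertex of the other colour, and the cofacets of the first
iterate, the minimal vertex covers, are the three cores: the pair of hubs and the two colour classes.
The later iterates are governed by a weight: the weight of a set is its cardinality, plus `2` if it
contains a core, plus `1` if it contains no core but meets both colours. For `3 ≤ t ≤ |V| + 1` the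
cofacets of the `t`-th iterate are the sets of weight `t - 1` together with the cores of weight
`t + 1` (`HubColoring.isCofacetFamily_iterate`). The induction rests on adding and removing single
vertices so that the weight changes by one (`HubColoring.exists_cofacet_superset`,
`HubColoring.exists_cofacet_subset`); the only obstacles are the jumps of the weight at the cores,
and these produce the extra cofacets. At `t = |V| + 1` the cofacets are the sets of cardinality
`|V| - 2` that contain a core, that is, the complements of the pairs that are not edges; so the next
iterate is the double star again (`HubColoring.iterate_card_add_two`), and
`|V| + 2 = p + q + 4`.

No earlier iterate is isomorphic to the double star if `|V| ≥ 5`: then there are three vertices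
besides the hubs, and any two of them form a face of each of the iterates in between
(`HubColoring.pair_mem_iterate`), whereas the double star is bipartite.
-/

/-! ### The NF-operator on cofacets -/

namespace VComplex

section NF

variable {V : Type*}

theorem faceMonomial_eq_monomial (k : Type*) [Field k] (F : Finset V) :
    faceMonomial k F = MvPolynomial.monomial (∑ v ∈ F, Finsupp.single v 1) 1 := by
  simp [faceMonomial, MvPolynomial.monomial_sum_one,
    MvPolynomial.X]

theorem sum_single_le_sum_single_iff (G F : Finset V) :
    (∑ v ∈ G, Finsupp.single v 1 : V →₀ ℕ) ≤ ∑ v ∈ F, Finsupp.single v 1 ↔ G ⊆ F := by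
  classical
  have key (H : Finset V) (x : V) :
      (∑ v ∈ H, Finsupp.single v 1 : V →₀ ℕ) x = if x ∈ H then 1 else 0 := by
    simp [Finsupp.finsetSum_apply, Finsupp.single_apply]
  constructor
  · intro hle x hx
    by_contra hxF
    have := hle x
    simp [key, hx, hxF] at this
  · intro hGF x
    rw [key, key]
    by_cases hx : x ∈ G
    · simp [hx, hGF hx]
    · simp [hx]

/-- The combinatorial content of the NF-operator: its value is independent of the field. -/
theorem mem_nf_iff (k : Type*) [Field k] (D : VComplex V) (F : Finset V) :
    F ∈ nf k D ↔ ∀ G, D.IsFacet G → ¬ G ⊆ F := by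
  have hset : {f | ∃ G : Finset V, D.IsFacet G ∧ f = faceMonomial k G} =
      (fun s => MvPolynomial.monomial s (1 : k)) ''
        {s | ∃ G : Finset V, D.IsFacet G ∧ s = ∑ v ∈ G, Finsupp.single v 1} := by
    ext f
    simp only [Set.mem_ofPred_eq, Set.mem_image, faceMonomial_eq_monomial]
    constructor
    · rintro ⟨G, hG, rfl⟩
      exact ⟨_, ⟨G, hG, rfl⟩, rfl⟩
    · rintro ⟨_, ⟨G, hG, rfl⟩, rfl⟩
      exact ⟨G, hG, rfl⟩
  change faceMonomial k F ∉ facetIdeal k D ↔ _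
  rw [facetIdeal, hset, MvPolynomial.mem_ideal_span_monomial_image, faceMonomial_eq_monomial]
  classical
  simp only [MvPolynomial.support_monomial, one_ne_zero, if_false, Finset.mem_singleton,
    forall_eq, Set.mem_ofPred_eq]
  constructor
  · intro hn G hG hGF
    exact hn ⟨_, ⟨G, hG, rfl⟩, (sum_single_le_sum_single_iff G F).2 hGF⟩
  · rintro hn ⟨_, ⟨G, hG, rfl⟩, hle⟩
    exact hn G hG ((sum_single_le_sum_single_iff G F).1 hle)

variable [Fintype V] [DecidableEq V]

/-- `N` is the family of the complements of the facets of `D`: the sets in `N` are pairwise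
incomparable, and a set is a face exactly when its complement contains a member of `N`. -/
structure IsCofacetFamily (D : VComplex V) (N : Set (Finset V)) : Prop where
  antichain : IsAntichain (· ⊆ ·) N
  mem_iff : ∀ F, F ∈ D ↔ ∃ M ∈ N, M ⊆ Fᶜ

theorem IsCofacetFamily.mem_nf_iff {D : VComplex V} {N : Set (Finset V)}
    (hD : D.IsCofacetFamily N) (k : Type*) [Field k] (F : Finset V) :
    F ∈ nf k D ↔ ∀ M ∈ N, ¬ Fᶜ ⊆ M := by
  have hfacet : ∀ G, D.IsFacet G ↔ Gᶜ ∈ N := by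
    intro G
    constructor
    · rintro ⟨hG, hmax⟩
      obtain ⟨M, hM, hMG⟩ := (hD.mem_iff G).1 hG
      have hGM : G ⊆ Mᶜ := Finset.subset_compl_comm.1 hMG
      have : Mᶜ ⊆ G := hmax ((hD.mem_iff _).2 ⟨M, hM, by simp⟩) hGM
      rwa [hGM.antisymm this, compl_compl]
    · intro hG
      refine ⟨(hD.mem_iff G).2 ⟨_, hG, subset_rfl⟩, fun H hH hGH => ?_⟩
      obtain ⟨M, hM, hMH⟩ := (hD.mem_iff H).1 hH
      have hMG : M ⊆ Gᶜ := hMH.trans (Finset.compl_subset_compl.2 hGH)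
      have := hD.antichain.eq hM hG hMG
      subst this
      exact Finset.compl_subset_compl.1 hMH
  rw [VComplex.mem_nf_iff]
  constructor
  · intro hF M hM hFM
    refine hF Mᶜ ((hfacet _).2 (by simpa using hM)) ?_
    rw [← compl_compl F]
    exact Finset.compl_subset_compl.2 hFM
  · intro hF G hG hGF
    exact hF _ ((hfacet G).1 hG) (Finset.compl_subset_compl.2 hGF)

/-- One step of the NF-operator on cofacets: the cofacets of `nf D` are the minimal sets not
contained in any cofacet of `D`. -/
theorem IsCofacetFamily.nf {D : VComplex V} {N N' : Set (Finset V)}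
    (hD : D.IsCofacetFamily N) (k : Type*) [Field k] (hN' : IsAntichain (· ⊆ ·) N')
    (h : ∀ C, (∃ M ∈ N', M ⊆ C) ↔ ∀ M ∈ N, ¬ C ⊆ M) : (nf k D).IsCofacetFamily N' :=
  ⟨hN', fun F => by rw [hD.mem_nf_iff k, h]⟩

theorem IsCofacetFamily.eq {D E : VComplex V} {N : Set (Finset V)}
    (hD : D.IsCofacetFamily N) (hE : E.IsCofacetFamily N) : D = E :=
  LowerSet.ext (Set.ext fun F => (hD.mem_iff F).trans (hE.mem_iff F).symm)

end NF

end VComplex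

/-! ### Vertices with two colours and two hubs -/

/-- A two-colouring `c` with a distinguished vertex `h i`, the hub, of each colour `i`, such that
every colour occurs at some vertex besides its hub. -/
structure IsHubColoring {V : Type*} (c : V → Bool) (h : Bool → V) : Prop where
  color_hub : ∀ i, c (h i) = i
  exists_ne_hub : ∀ i, ∃ x, c x = i ∧ x ≠ h i

namespace HubColoring

set_option linter.unusedSectionVars false

variable {V : Type*} [Fintype V] [DecidableEq V] (c : V → Bool) (h : Bool → V)

/-- The set of the two hubs. -/
def hubs : Finset V := {h false, h true}

/-- The vertices of colour `i`. -/
def colorClass (i : Bool) : Finset V := Finset.univ.filter (c · = i)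

/-- A core is the pair of hubs or one of the two colour classes. -/
def IsCore (M : Finset V) : Prop := M = hubs h ∨ ∃ i, M = colorClass c i

/-- The set contains a core. -/
def HasCore (C : Finset V) : Prop := ∃ M, IsCore c h M ∧ M ⊆ C

/-- All vertices of the set have the same colour. -/
def Mono (C : Finset V) : Prop := ∃ i, ∀ x ∈ C, c x = i

open Classical in
/-- The cardinality of a set, raised by `2` if the set contains a core, and by `1` if it contains
no core but meets both colours. -/
noncomputable def weight (C : Finset V) : ℕ :=
  C.card + if HasCore c h C then 2 else if Mono c C then 0 else 1

variable {c h}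

theorem mem_hubs {x : V} : x ∈ hubs h ↔ ∃ i, x = h i := by simp [hubs]

theorem mem_colorClass {i : Bool} {x : V} : x ∈ colorClass c i ↔ c x = i := by simp [colorClass]

theorem hasCore_iff {C : Finset V} :
    HasCore c h C ↔ (∀ i, h i ∈ C) ∨ ∃ i, ∀ x, c x = i → x ∈ C := by
  constructor
  · rintro ⟨M, rfl | ⟨i, rfl⟩, hM⟩
    · exact Or.inl fun i => hM (mem_hubs.2 ⟨i, rfl⟩)
    · exact Or.inr ⟨i, fun x hx => hM (mem_colorClass.2 hx)⟩
  · rintro (hC | ⟨i, hC⟩)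
    · refine ⟨hubs h, Or.inl rfl, fun x hx => ?_⟩
      obtain ⟨i, rfl⟩ := mem_hubs.1 hx
      exact hC i
    · exact ⟨_, Or.inr ⟨i, rfl⟩, fun x hx => hC x (mem_colorClass.1 hx)⟩

theorem HasCore.mono {C C' : Finset V} (hC : HasCore c h C) (hCC' : C ⊆ C') : HasCore c h C' := by
  obtain ⟨M, hM, hMC⟩ := hC
  exact ⟨M, hM, hMC.trans hCC'⟩

theorem IsCore.hasCore {M : Finset V} (hM : IsCore c h M) : HasCore c h M := ⟨M, hM, subset_rfl⟩

theorem Mono.subset {C C' : Finset V} (hC : Mono c C') (hCC' : C ⊆ C') : Mono c C := by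
  obtain ⟨i, hi⟩ := hC
  exact ⟨i, fun x hx => hi x (hCC' hx)⟩

theorem not_mono_iff {C : Finset V} : ¬ Mono c C ↔ ∀ i, ∃ x ∈ C, c x = i := by
  constructor
  · intro hC i
    by_contra! hn
    exact hC ⟨!i, fun x hx => by have := hn x hx; cases i <;> simp_all⟩
  · rintro hC ⟨i, hi⟩
    obtain ⟨x, hx, hxi⟩ := hC (!i)
    have := hi x hx
    cases i <;> simp_all

theorem mono_pair {x y : V} (hxy : c x = c y) : Mono c {x, y} :=
  ⟨c x, fun z hz => by
    rcases Finset.mem_insert.1 hz with rfl | hz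
    · rfl
    · rw [Finset.mem_singleton.1 hz, hxy]⟩

theorem weight_of_hasCore {C : Finset V} (hC : HasCore c h C) : weight c h C = C.card + 2 := by
  simp [weight, hC]

theorem weight_of_mono {C : Finset V} (hC : ¬ HasCore c h C) (hm : Mono c C) :
    weight c h C = C.card := by
  simp [weight, hC, hm]

theorem weight_of_not_mono {C : Finset V} (hC : ¬ HasCore c h C) (hm : ¬ Mono c C) :
    weight c h C = C.card + 1 := by
  simp [weight, hC, hm]

theorem card_le_weight (C : Finset V) : C.card ≤ weight c h C := Nat.le_add_right _ _

theorem weight_le_card_add_two (C : Finset V) : weight c h C ≤ C.card + 2 := by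
  unfold weight; split_ifs <;> omega

theorem weight_lt_weight {C C' : Finset V} (hC : C ⊂ C') : weight c h C < weight c h C' := by
  have hcard := Finset.card_lt_card hC
  by_cases h1 : HasCore c h C'
  · have := weight_le_card_add_two (c := c) (h := h) C
    rw [weight_of_hasCore h1]; omega
  · have h2 : ¬ HasCore c h C := fun hh => h1 (hh.mono hC.subset)
    by_cases h3 : Mono c C'
    · rwa [weight_of_mono h1 h3, weight_of_mono h2 (h3.subset hC.subset)]
    · rw [weight_of_not_mono h1 h3]
      by_cases h4 : Mono c C
      · rw [weight_of_mono h2 h4]; omega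
      · rw [weight_of_not_mono h2 h4]; omega

theorem weight_le_weight {C C' : Finset V} (hC : C ⊆ C') : weight c h C ≤ weight c h C' := by
  rcases hC.eq_or_ssubset with rfl | hC
  · rfl
  · exact (weight_lt_weight hC).le

theorem color_eq_or (i : Bool) (x : V) : c x = i ∨ c x = !i := by
  cases c x <;> cases i <;> simp

/-- A set contains no core exactly when it is disjoint from some edge of the double star, an edge
being a hub together with a vertex of the other colour. -/
theorem not_hasCore_iff (H : IsHubColoring c h) {C : Finset V} :
    ¬ HasCore c h C ↔ ∃ i z, h i ∉ C ∧ c z = !i ∧ z ∉ C := by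
  rw [hasCore_iff]
  push Not
  constructor
  · rintro ⟨⟨i, hi⟩, hz⟩
    obtain ⟨z, hz, hzC⟩ := hz (!i)
    exact ⟨i, z, hi, hz, hzC⟩
  · rintro ⟨i, z, hi, hz, hzC⟩
    refine ⟨⟨i, hi⟩, fun j => ?_⟩
    by_cases hj : j = i
    · exact ⟨h i, hj ▸ H.color_hub i, hi⟩
    · exact ⟨z, by cases i <;> cases j <;> simp_all, hzC⟩

/-- A proper subset of a core contains no core, and is monochromatic. -/
theorem IsCore.of_ssubset (H : IsHubColoring c h) {C M : Finset V} (hM : IsCore c h M)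
    (hCM : C ⊂ M) : ¬ HasCore c h C ∧ Mono c C := by
  rw [not_hasCore_iff H]
  obtain ⟨x, hxM, hxC⟩ := Finset.exists_of_ssubset hCM
  rcases hM with rfl | ⟨i, rfl⟩
  · obtain ⟨i, rfl⟩ := mem_hubs.1 hxM
    have hsub : ∀ y ∈ C, y = h (!i) := by
      intro y hy
      obtain ⟨j, rfl⟩ := mem_hubs.1 (hCM.subset hy)
      rcases Bool.eq_or_eq_not j i with rfl | rfl
      · exact absurd hy hxC
      · rfl
    constructor
    · obtain ⟨z, hz, hzh⟩ := H.exists_ne_hub (!i)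
      exact ⟨i, z, hxC, hz, fun hzC => hzh (hsub z hzC)⟩
    · exact ⟨!i, fun y hy => by rw [hsub y hy, H.color_hub]⟩
  · have hsub : ∀ y ∈ C, c y = i := fun y hy => mem_colorClass.1 (hCM.subset hy)
    refine ⟨⟨!i, x, fun hh => ?_, by simpa using mem_colorClass.1 hxM, hxC⟩, i, hsub⟩
    have := hsub _ hh
    rw [H.color_hub] at this
    cases i <;> simp at this

theorem IsCore.weight_add_three_le (H : IsHubColoring c h) {C M : Finset V} (hM : IsCore c h M)
    (hCM : C ⊂ M) : weight c h C + 3 ≤ weight c h M := by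
  obtain ⟨h1, h2⟩ := hM.of_ssubset H hCM
  have := Finset.card_lt_card hCM
  rw [weight_of_mono h1 h2, weight_of_hasCore hM.hasCore]
  omega

theorem isAntichain_isCore (H : IsHubColoring c h) :
    IsAntichain (· ⊆ ·) {M | IsCore c h M} := fun _ hM _ hM' hne hsub =>
  (hM'.of_ssubset H (hsub.ssubset_of_ne hne)).1 hM.hasCore

theorem card_hubs (H : IsHubColoring c h) : (hubs h).card = 2 := by
  refine Finset.card_pair fun he => ?_
  have := congrArg c he
  simp [H.color_hub] at this

theorem two_le_card_colorClass (H : IsHubColoring c h) (i : Bool) :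
    2 ≤ (colorClass c i).card := by
  obtain ⟨x, hx, hxh⟩ := H.exists_ne_hub i
  exact Finset.one_lt_card.2
    ⟨x, mem_colorClass.2 hx, h i, mem_colorClass.2 (H.color_hub i), hxh⟩

theorem mono_of_card_le_one {C : Finset V} (hC : C.card ≤ 1) : Mono c C := by
  rcases C.eq_empty_or_nonempty with rfl | ⟨x, hx⟩
  · exact ⟨true, by simp⟩
  · exact ⟨c x, fun y hy => by rw [Finset.card_le_one.1 hC y hy x hx]⟩

theorem weight_of_card_le_one (H : IsHubColoring c h) {C : Finset V} (hC : C.card ≤ 1) :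
    weight c h C = C.card := by
  refine weight_of_mono (fun hcore => ?_) (mono_of_card_le_one hC)
  obtain ⟨M, hM, hMC⟩ := hcore
  have := Finset.card_le_card hMC
  rcases hM with rfl | ⟨i, rfl⟩
  · have := card_hubs H; omega
  · have := two_le_card_colorClass H i; omega

theorem hasCore_of_card_compl_le_one (H : IsHubColoring c h) {C : Finset V} (hC : Cᶜ.card ≤ 1) :
    HasCore c h C := by
  by_contra hn
  obtain ⟨i, z, hi, hz, hzC⟩ := (not_hasCore_iff H).1 hn
  have := Finset.card_le_one.1 hC _ (Finset.mem_compl.2 hi) _ (Finset.mem_compl.2 hzC)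
  rw [← this, H.color_hub] at hz
  simp at hz

/-! ### The cofacets of the iterates -/

variable (c h)

/-- The sets that are the cofacets of the `t`-th iterate for `3 ≤ t ≤ |V| + 1`: those of weight
`t - 1`, and the cores of weight `t + 1`. The latter are minimal as well, since the proper subsets
of a core weigh at least three less than the core. -/
def cofacets (t : ℕ) : Set (Finset V) :=
  {M | weight c h M + 1 = t ∨ IsCore c h M ∧ weight c h M = t + 1}

/-- The cofacets of the double star: the complements of its edges. -/
def edgeCompls : Set (Finset V) :=
  {M | ∃ i x, c x = (!i) ∧ M = {h i, x}ᶜ}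

/-- The cofacets of the second iterate: the pairs of vertices of different colours, except the
pair of hubs. -/
def bicoloredPairs : Set (Finset V) :=
  {M | ∃ x y, c x ≠ c y ∧ M = {x, y} ∧ M ≠ hubs h}

variable {c h}

theorem isAntichain_cofacets (H : IsHubColoring c h) (t : ℕ) :
    IsAntichain (· ⊆ ·) (cofacets c h t) := by
  intro M hM M' hM' hne hsub
  have hss := hsub.ssubset_of_ne hne
  have hlt := weight_lt_weight (c := c) (h := h) hss
  rcases hM' with hM' | ⟨hcore, hM'⟩
  · rcases hM with hM | ⟨-, hM⟩ <;> omega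
  · have := hcore.weight_add_three_le H hss
    rcases hM with hM | ⟨-, hM⟩ <;> omega

theorem card_edge (H : IsHubColoring c h) {i : Bool} {x : V} (hx : c x = !i) :
    ({h i, x} : Finset V).card = 2 := by
  refine Finset.card_pair ?_
  rintro rfl
  rw [H.color_hub] at hx
  simp at hx

theorem card_bicoloredPair {M : Finset V} (hM : M ∈ bicoloredPairs c h) : M.card = 2 := by
  obtain ⟨x, y, hxy, rfl, -⟩ := hM
  exact Finset.card_pair fun he => hxy (he ▸ rfl)

theorem weight_bicoloredPair (H : IsHubColoring c h) {M : Finset V}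
    (hM : M ∈ bicoloredPairs c h) : weight c h M = 3 := by
  have hcard := card_bicoloredPair hM
  obtain ⟨x, y, hxy, rfl, hne⟩ := hM
  have hmono : ¬ Mono c {x, y} := by
    rintro ⟨i, hi⟩
    exact hxy ((hi x (by simp)).trans (hi y (by simp)).symm)
  rw [weight_of_not_mono _ hmono, hcard]
  rintro ⟨K, hK, hsub⟩
  rcases hK with rfl | ⟨i, rfl⟩
  · exact hne (Finset.eq_of_subset_of_card_le hsub (by rw [hcard, card_hubs H])).symm
  · have heq := Finset.eq_of_subset_of_card_le hsub
      (by rw [hcard]; exact two_le_card_colorClass H i)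
    exact hmono ⟨i, fun z hz => mem_colorClass.1 (heq ▸ hz)⟩

theorem isAntichain_edgeCompls (H : IsHubColoring c h) :
    IsAntichain (· ⊆ ·) (edgeCompls c h) :=
  Set.Sized.isAntichain (r := Fintype.card V - 2) (by
    rintro _ ⟨i, x, hx, rfl⟩
    rw [Finset.card_compl, card_edge H hx])

theorem isAntichain_bicoloredPairs : IsAntichain (· ⊆ ·) (bicoloredPairs c h) :=
  Set.Sized.isAntichain fun _ hM => card_bicoloredPair hM

/-! ### The first steps -/

theorem exists_core_subset_iff (H : IsHubColoring c h) (C : Finset V) :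
    (∃ M ∈ {M | IsCore c h M}, M ⊆ C) ↔ ∀ M ∈ edgeCompls c h, ¬ C ⊆ M := by
  change HasCore c h C ↔ _
  rw [← not_iff_not, not_hasCore_iff H]
  push Not
  constructor
  · rintro ⟨i, z, hi, hz, hzC⟩
    refine ⟨_, ⟨i, z, hz, rfl⟩, fun y hy => ?_⟩
    rw [Finset.mem_compl, Finset.mem_insert, Finset.mem_singleton]
    rintro (rfl | rfl) <;> contradiction
  · rintro ⟨_, ⟨i, z, hz, rfl⟩, hsub⟩
    exact ⟨i, z, fun hh => by simpa using hsub hh, hz, fun hh => by simpa using hsub hh⟩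

theorem exists_bicoloredPair_subset_iff (H : IsHubColoring c h) (C : Finset V) :
    (∃ M ∈ bicoloredPairs c h, M ⊆ C) ↔ ∀ M ∈ {M | IsCore c h M}, ¬ C ⊆ M := by
  constructor
  · rintro ⟨M, hM, hMC⟩ K (rfl | ⟨i, rfl⟩) hCK
    · obtain ⟨-, -, -, -, hne⟩ := id hM
      exact hne (Finset.eq_of_subset_of_card_le (hMC.trans hCK)
        (by rw [card_bicoloredPair hM, card_hubs H]))
    · obtain ⟨x, y, hxy, rfl, -⟩ := hM
      have hcol : ∀ z ∈ ({x, y} : Finset V), c z = i := fun z hz =>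
        mem_colorClass.1 (hCK (hMC hz))
      exact hxy ((hcol x (by simp)).trans (hcol y (by simp)).symm)
  · intro hC
    have hmono : ¬ Mono c C := by
      rintro ⟨i, hi⟩
      exact hC _ (Or.inr ⟨i, rfl⟩) fun x hx => mem_colorClass.2 (hi x hx)
    obtain ⟨z, hzC, hz⟩ := Finset.not_subset.1 (hC _ (Or.inl rfl))
    obtain ⟨y, hyC, hy⟩ := not_mono_iff.1 hmono (!(c z))
    refine ⟨{z, y}, ⟨z, y, by rw [hy]; simp, rfl, fun he => hz (he ▸ by simp)⟩, ?_⟩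
    intro w hw
    rcases Finset.mem_insert.1 hw with rfl | hw
    · exact hzC
    · rwa [Finset.mem_singleton.1 hw]

/-- Every vertex lies in a two-coloured pair other than the pair of hubs. -/
theorem exists_mem_bicoloredPair (H : IsHubColoring c h) (x : V) :
    ∃ M ∈ bicoloredPairs c h, x ∈ M := by
  obtain ⟨y, hy, hyh⟩ := H.exists_ne_hub (!(c x))
  refine ⟨{x, y}, ⟨x, y, by rw [hy]; simp, rfl, fun he => ?_⟩, by simp⟩
  have : y ∈ hubs h := he ▸ by simp
  obtain ⟨i, rfl⟩ := mem_hubs.1 this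
  rw [H.color_hub] at hy
  exact hyh (hy ▸ rfl)

theorem monoPair_mem_cofacets (H : IsHubColoring c h) {x y : V} (hne : x ≠ y) (hxy : c x = c y) :
    {x, y} ∈ cofacets c h 3 := by
  by_cases hcore : HasCore c h {x, y}
  · obtain ⟨M, hM, hsub⟩ := id hcore
    rcases hsub.eq_or_ssubset with rfl | hss
    · exact Or.inr ⟨hM, by rw [weight_of_hasCore hcore, Finset.card_pair hne]⟩
    · have h1 := Finset.card_lt_card hss
      rw [Finset.card_pair hne] at h1
      have h2 := weight_of_card_le_one H (C := M) (by omega)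
      rw [weight_of_hasCore hM.hasCore] at h2
      omega
  · exact Or.inl (by rw [weight_of_mono hcore (mono_pair hxy), Finset.card_pair hne])

theorem exists_cofacet_three_subset_iff (H : IsHubColoring c h) (C : Finset V) :
    (∃ M ∈ cofacets c h 3, M ⊆ C) ↔ ∀ M ∈ bicoloredPairs c h, ¬ C ⊆ M := by
  constructor
  · rintro ⟨M, hM, hMC⟩ K hK hCK
    have hK3 := weight_bicoloredPair H hK
    rcases (hMC.trans hCK).eq_or_ssubset with rfl | hss
    · rcases hM with hM | ⟨hM, hw⟩
      · omega
      · rw [weight_of_hasCore hM.hasCore, card_bicoloredPair hK] at hK3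
        omega
    · have hcard := Finset.card_lt_card hss
      rw [card_bicoloredPair hK] at hcard
      have := weight_of_card_le_one H (C := M) (by omega)
      rcases hM with hM | ⟨-, hM⟩ <;> omega
  · intro hC
    by_cases hpair : ∃ x ∈ C, ∃ y ∈ C, x ≠ y ∧ c x = c y
    · obtain ⟨x, hx, y, hy, hne, hxy⟩ := hpair
      refine ⟨_, monoPair_mem_cofacets H hne hxy, fun z hz => ?_⟩
      rcases Finset.mem_insert.1 hz with rfl | hz
      · exact hx
      · rwa [Finset.mem_singleton.1 hz]
    · push Not at hpair
      have hinj : ∀ x ∈ C, ∀ y ∈ C, c x = c y → x = y := fun x hx y hy hxy => by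
        by_contra hne
        exact hpair x hx y hy hne hxy
      by_cases hmono : Mono c C
      · obtain ⟨i, hi⟩ := hmono
        rcases C.eq_empty_or_nonempty with rfl | ⟨x, hx⟩
        · obtain ⟨M, hM, -⟩ := exists_mem_bicoloredPair H (h true)
          exact absurd (Finset.empty_subset M) (hC M hM)
        · obtain ⟨M, hM, hxM⟩ := exists_mem_bicoloredPair H x
          refine absurd (fun y hy => ?_) (hC M hM)
          rwa [hinj y hy x hx ((hi y hy).trans (hi x hx).symm)]
      · obtain ⟨x, hx, hxc⟩ := not_mono_iff.1 hmono true
        obtain ⟨y, hy, hyc⟩ := not_mono_iff.1 hmono false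
        have hsub : C ⊆ {x, y} := fun z hz => by
          rw [Finset.mem_insert, Finset.mem_singleton]
          cases hzc : c z
          · exact Or.inr (hinj z hz y hy (hzc.trans hyc.symm))
          · exact Or.inl (hinj z hz x hx (hzc.trans hxc.symm))
        have hsup : ({x, y} : Finset V) ⊆ C := fun z hz => by
          rcases Finset.mem_insert.1 hz with rfl | hz
          · exact hx
          · rwa [Finset.mem_singleton.1 hz]
        obtain rfl := hsub.antisymm hsup
        have hh : {x, y} = hubs h := by
          by_contra hne
          exact hC _ ⟨x, y, by rw [hxc, hyc]; simp, rfl, hne⟩ subset_rfl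
        rw [hh]
        refine ⟨hubs h, Or.inr ⟨Or.inl rfl, ?_⟩, subset_rfl⟩
        rw [weight_of_hasCore (IsCore.hasCore (Or.inl rfl)), card_hubs H]

/-! ### Changing the weight one vertex at a time -/

theorem HasCore.exists_weight_insert {C : Finset V} (hC : HasCore c h C)
    (hcard : C.card < Fintype.card V) :
    ∃ x, x ∉ C ∧ weight c h (insert x C) = weight c h C + 1 := by
  obtain ⟨x, hx⟩ : ∃ x, x ∉ C := by
    by_contra! hn
    rw [Finset.eq_univ_iff_forall.2 hn, Finset.card_univ] at hcard
    exact lt_irrefl _ hcard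
  refine ⟨x, hx, ?_⟩
  rw [weight_of_hasCore hC, weight_of_hasCore (hC.mono (Finset.subset_insert x C)),
    Finset.card_insert_of_notMem hx]

/-- A set of weight at most `|V| - 2` that meets both colours can be enlarged by one vertex so that
the weight grows by one: if it contains no core, then its complement contains an edge and at least
one vertex more, which is the vertex to add. -/
theorem exists_weight_insert_of_not_mono (H : IsHubColoring c h) {C : Finset V}
    (hm : ¬ Mono c C) (hw : weight c h C + 2 ≤ Fintype.card V) :
    ∃ x, x ∉ C ∧ weight c h (insert x C) = weight c h C + 1 := by
  by_cases hC : HasCore c h C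
  · exact hC.exists_weight_insert (by rw [weight_of_hasCore hC] at hw; omega)
  · rw [weight_of_not_mono hC hm] at hw ⊢
    obtain ⟨i, z, hi, hz, hzC⟩ := (not_hasCore_iff H).1 hC
    obtain ⟨x, hxC, hx⟩ : ∃ x ∈ Cᶜ, x ∉ ({h i, z} : Finset V) := by
      refine Finset.exists_mem_notMem_of_card_lt_card ?_
      rw [card_edge H hz, Finset.card_compl]
      omega
    rw [Finset.mem_compl] at hxC
    rw [Finset.mem_insert, Finset.mem_singleton, not_or] at hx
    refine ⟨x, hxC, ?_⟩
    rw [weight_of_not_mono _ fun hh => hm (hh.subset (Finset.subset_insert x C)),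
      Finset.card_insert_of_notMem hxC]
    rw [not_hasCore_iff H]
    exact ⟨i, z, by simp [hi, Ne.symm hx.1], hz, by simp [hzC, Ne.symm hx.2]⟩

/-- For a monochromatic set there is one exception, a colour class with one vertex removed. The
weight jumps by three when the class is completed, but only by two when a vertex other than the hub
of the other colour is added. -/
theorem Mono.exists_weight_insert (H : IsHubColoring c h) {C : Finset V}
    (hm : Mono c C) (hw : weight c h C + 2 ≤ Fintype.card V) :
    (∃ x, x ∉ C ∧ weight c h (insert x C) = weight c h C + 1) ∨
      ∃ i, C ⊆ colorClass c i ∧ weight c h C + 3 = weight c h (colorClass c i) ∧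
        ∃ x, x ∉ C ∧ weight c h (insert x C) = weight c h C + 2 := by
  by_cases hC : HasCore c h C
  · exact Or.inl (hC.exists_weight_insert (by rw [weight_of_hasCore hC] at hw; omega))
  obtain ⟨i, hi⟩ := id hm
  have hsub : C ⊆ colorClass c i := fun x hx => mem_colorClass.2 (hi x hx)
  obtain ⟨x, hx, hxC⟩ : ∃ x, c x = i ∧ x ∉ C := by
    by_contra! hn
    exact hC (hasCore_iff.2 (Or.inr ⟨i, hn⟩))
  have hnot : h (!i) ∉ C := fun hh => by simpa [H.color_hub] using hi _ hh
  by_cases hy : ∃ y, c y = i ∧ y ∉ C ∧ y ≠ x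
  · left
    obtain ⟨y, hy, hyC, hyx⟩ := hy
    refine ⟨x, hxC, ?_⟩
    rw [weight_of_mono hC hm, weight_of_mono, Finset.card_insert_of_notMem hxC]
    · rw [not_hasCore_iff H]
      refine ⟨!i, y, ?_, by simpa using hy, by simp [hyC, hyx]⟩
      rw [Finset.mem_insert, not_or]
      refine ⟨?_, hnot⟩
      rintro rfl
      simp [H.color_hub] at hx
    · refine ⟨i, fun z hz => ?_⟩
      rcases Finset.mem_insert.1 hz with rfl | hz
      exacts [hx, hi z hz]
  · right
    push Not at hy
    have hins : insert x C = colorClass c i := by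
      ext y
      rw [Finset.mem_insert, mem_colorClass]
      constructor
      · rintro (rfl | hy')
        exacts [hx, hi y hy']
      · intro hyi
        by_contra! hn
        exact hn.1 (hy y hyi hn.2)
    have hcard : C.card + 1 = (colorClass c i).card := by
      rw [← hins, Finset.card_insert_of_notMem hxC]
    refine ⟨i, hsub, ?_, ?_⟩
    · rw [weight_of_mono hC hm, weight_of_hasCore (IsCore.hasCore (Or.inr ⟨i, rfl⟩))]
      omega
    · obtain ⟨b, hb, hbh⟩ := H.exists_ne_hub (!i)
      have hbC : b ∉ C := fun hbC => by simpa [hb] using hi b hbC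
      obtain ⟨y, hyC⟩ : C.Nonempty := by
        rw [← Finset.card_pos]
        have := two_le_card_colorClass H i
        omega
      refine ⟨b, hbC, ?_⟩
      rw [weight_of_mono hC hm, weight_of_not_mono, Finset.card_insert_of_notMem hbC]
      · rw [not_hasCore_iff H]
        refine ⟨!i, x, by simp [hnot, Ne.symm hbh], by simpa using hx, ?_⟩
        rw [Finset.mem_insert, not_or]
        refine ⟨?_, hxC⟩
        rintro rfl
        simp [hx] at hb
      · rintro ⟨j, hj⟩
        have h1 := hj b (by simp)
        have h2 := hj y (by simp [hyC])
        rw [hi y hyC] at h2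
        rw [hb, ← h2] at h1
        cases i <;> simp at h1

/-- Every set of weight less than `t` lies in a cofacet of the `t`-th iterate: it can be enlarged
vertex by vertex until it has weight `t - 1`, or is a colour class of weight `t + 1`. -/
theorem exists_cofacet_superset (H : IsHubColoring c h) {t : ℕ} (ht : t ≤ Fintype.card V)
    (C : Finset V) (hC : weight c h C + 1 ≤ t) : ∃ M ∈ cofacets c h t, C ⊆ M := by
  induction hn : t - weight c h C using Nat.strong_induction_on generalizing C with
  | _ n ih =>
    subst hn
    rcases hC.eq_or_lt with heq | hlt
    · exact ⟨C, Or.inl heq, subset_rfl⟩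
    have step : ∀ x, weight c h C < weight c h (insert x C) → weight c h (insert x C) + 1 ≤ t →
        ∃ M ∈ cofacets c h t, C ⊆ M := by
      intro x h1 h2
      obtain ⟨M, hM, hsub⟩ := ih _ (by omega) (insert x C) h2 rfl
      exact ⟨M, hM, (Finset.subset_insert x C).trans hsub⟩
    have hcase : (∃ x, x ∉ C ∧ weight c h (insert x C) = weight c h C + 1) ∨
        ∃ i, C ⊆ colorClass c i ∧ weight c h C + 3 = weight c h (colorClass c i) ∧
          ∃ x, x ∉ C ∧ weight c h (insert x C) = weight c h C + 2 := by
      by_cases hm : Mono c C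
      · exact hm.exists_weight_insert H (by omega)
      · exact Or.inl (exists_weight_insert_of_not_mono H hm (by omega))
    rcases hcase with ⟨x, -, hx⟩ | ⟨i, hsub, hi, x, -, hx⟩
    · exact step x (by omega) (by omega)
    · by_cases ht3 : weight c h C + 3 ≤ t
      · exact step x (by omega) (by omega)
      · exact ⟨_, Or.inr ⟨Or.inr ⟨i, rfl⟩, by omega⟩, hsub⟩

/-- A set of weight at least `4` that is not a core loses exactly one unit of weight on the removal
of a suitable vertex. -/
theorem exists_weight_erase {C : Finset V} (hC : ¬ IsCore c h C) (hw : 4 ≤ weight c h C) :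
    ∃ x ∈ C, weight c h (C.erase x) + 1 = weight c h C := by
  by_cases hcore : HasCore c h C
  · obtain ⟨M, hM, hMC⟩ := id hcore
    have hss : M ⊂ C := hMC.ssubset_of_ne fun he => hC (he ▸ hM)
    obtain ⟨x, hxC, hxM⟩ := Finset.exists_of_ssubset hss
    refine ⟨x, hxC, ?_⟩
    have := Finset.card_erase_add_one hxC
    rw [weight_of_hasCore hcore,
      weight_of_hasCore ⟨M, hM, Finset.subset_erase.2 ⟨hMC, hxM⟩⟩]
    omega
  have herase : ∀ x, ¬ HasCore c h (C.erase x) := fun x hh =>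
    hcore (hh.mono (Finset.erase_subset x C))
  by_cases hm : Mono c C
  · rw [weight_of_mono hcore hm] at hw ⊢
    obtain ⟨x, hx⟩ : C.Nonempty := Finset.card_pos.1 (by omega)
    exact ⟨x, hx, by rw [weight_of_mono (herase x) (hm.subset (Finset.erase_subset x C)),
      Finset.card_erase_add_one hx]⟩
  · rw [weight_of_not_mono hcore hm] at hw ⊢
    obtain ⟨x, hx, hxc⟩ := not_mono_iff.1 hm true
    obtain ⟨y, hy, hyc⟩ := not_mono_iff.1 hm false
    obtain ⟨z, hzC, hz⟩ : ∃ z ∈ C, z ∉ ({x, y} : Finset V) := by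
      refine Finset.exists_mem_notMem_of_card_lt_card ?_
      have := Finset.card_le_two (a := x) (b := y)
      omega
    rw [Finset.mem_insert, Finset.mem_singleton, not_or] at hz
    refine ⟨z, hzC, ?_⟩
    rw [weight_of_not_mono (herase z), Finset.card_erase_add_one hzC]
    refine not_mono_iff.2 fun i => ?_
    cases i
    · exact ⟨y, Finset.mem_erase.2 ⟨Ne.symm hz.2, hy⟩, hyc⟩
    · exact ⟨x, Finset.mem_erase.2 ⟨Ne.symm hz.1, hx⟩, hxc⟩

/-- A core with one more vertex loses two units of weight on the removal of a suitable hub. -/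
theorem IsCore.exists_weight_erase_insert (H : IsHubColoring c h) {K : Finset V}
    (hK : IsCore c h K) {y : V} (hy : y ∉ K) :
    ∃ x, weight c h ((insert y K).erase x) = weight c h K - 1 := by
  -- It suffices to find a hub `h i` whose removal leaves both colours, but not all of colour `!i`.
  suffices hs : ∃ i, h i ∈ K ∧ (∃ z ∈ insert y K, c z = i ∧ z ≠ h i) ∧
      (∃ z ∈ insert y K, c z = !i) ∧ ∃ z, z ∉ insert y K ∧ c z = !i by
    obtain ⟨i, hi, ⟨a, haK, ha, hah⟩, ⟨b, hbK, hb⟩, z, hzK, hz⟩ := hs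
    refine ⟨h i, ?_⟩
    have hbh : b ≠ h i := by
      rintro rfl
      rw [H.color_hub] at hb
      simp at hb
    rw [weight_of_hasCore hK.hasCore, weight_of_not_mono,
      Finset.card_erase_of_mem (Finset.mem_insert_of_mem hi), Finset.card_insert_of_notMem hy]
    · omega
    · rw [not_hasCore_iff H]
      exact ⟨i, z, by simp, hz, fun hh => hzK (Finset.mem_of_mem_erase hh)⟩
    · rintro ⟨j, hj⟩
      have h1 := hj a (Finset.mem_erase.2 ⟨hah, haK⟩)
      have h2 := hj b (Finset.mem_erase.2 ⟨hbh, hbK⟩)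
      rw [ha] at h1
      rw [hb, ← h1] at h2
      cases i <;> simp at h2
  rcases hK with rfl | ⟨i, rfl⟩
  · have hyh : ∀ i, y ≠ h i := fun i he => hy (mem_hubs.2 ⟨i, he⟩)
    refine ⟨c y, mem_hubs.2 ⟨_, rfl⟩, ⟨y, by simp, rfl, hyh _⟩,
      ⟨h (!(c y)), Finset.mem_insert_of_mem (mem_hubs.2 ⟨_, rfl⟩), H.color_hub _⟩, ?_⟩
    obtain ⟨z, hz, hzh⟩ := H.exists_ne_hub (!(c y))
    refine ⟨z, ?_, hz⟩
    rw [Finset.mem_insert, mem_hubs, not_or]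
    refine ⟨?_, ?_⟩
    · rintro rfl
      cases hc : c z <;> simp [hc] at hz
    · rintro ⟨j, rfl⟩
      rw [H.color_hub] at hz
      exact hzh (hz ▸ rfl)
  · have hyi : c y = !i := (color_eq_or i y).resolve_left fun he => hy (mem_colorClass.2 he)
    refine ⟨i, mem_colorClass.2 (H.color_hub i), ?_, ⟨y, by simp, hyi⟩, ?_⟩
    · obtain ⟨z, hz, hzh⟩ := H.exists_ne_hub i
      exact ⟨z, Finset.mem_insert_of_mem (mem_colorClass.2 hz), hz, hzh⟩
    · have hlt : ({y} : Finset V).card < (colorClass c (!i)).card := by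
        have := two_le_card_colorClass H (!i)
        rw [Finset.card_singleton]
        omega
      obtain ⟨z, hz, hzy⟩ := Finset.exists_mem_notMem_of_card_lt_card hlt
      rw [mem_colorClass] at hz
      rw [Finset.mem_singleton] at hzy
      refine ⟨z, ?_, hz⟩
      rw [Finset.mem_insert, mem_colorClass, not_or]
      exact ⟨hzy, by rw [hz]; simp⟩

/-- Every set of weight at least `t - 1`, except the cores of weight `t`, contains a cofacet of the
`t`-th iterate. The descent has to avoid the cores of weight `t`, from which the next removal would
lead to weight `t - 3` or less. -/
theorem exists_cofacet_subset (H : IsHubColoring c h) {t : ℕ} (ht : 4 ≤ t) (C : Finset V)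
    (hC : t ≤ weight c h C + 1) (hX : ¬ (IsCore c h C ∧ weight c h C = t)) :
    ∃ M ∈ cofacets c h t, M ⊆ C := by
  induction C using Finset.strongInduction with
  | H C ih =>
    by_cases heq : weight c h C + 1 = t
    · exact ⟨C, Or.inl heq, subset_rfl⟩
    by_cases hcore : IsCore c h C
    · have hne : weight c h C ≠ t := fun he => hX ⟨hcore, he⟩
      by_cases heq' : weight c h C = t + 1
      · exact ⟨C, Or.inr ⟨hcore, heq'⟩, subset_rfl⟩
      -- Here `C` is a colour class of cardinality at least `t`.
      rw [weight_of_hasCore hcore.hasCore] at *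
      obtain ⟨x, hx⟩ : C.Nonempty := Finset.card_pos.1 (by omega)
      have hss := Finset.erase_ssubset hx
      obtain ⟨h1, -⟩ := hcore.of_ssubset H hss
      have h3 := card_le_weight (c := c) (h := h) (C.erase x)
      rw [Finset.card_erase_of_mem hx] at h3
      obtain ⟨M, hM, hsub⟩ := ih _ hss (by omega) fun hh => h1 hh.1.hasCore
      exact ⟨M, hM, hsub.trans hss.subset⟩
    · obtain ⟨x, hx, hwx⟩ := exists_weight_erase hcore (by omega)
      have hss := Finset.erase_ssubset hx
      by_cases hX' : IsCore c h (C.erase x) ∧ weight c h (C.erase x) = t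
      · obtain ⟨y, hy⟩ := hX'.1.exists_weight_erase_insert H (Finset.notMem_erase x C)
        rw [Finset.insert_erase hx] at hy
        exact ⟨C.erase y, Or.inl (by omega), Finset.erase_subset y C⟩
      · obtain ⟨M, hM, hsub⟩ := ih _ hss (by omega) hX'
        exact ⟨M, hM, hsub.trans hss.subset⟩

theorem exists_cofacet_succ_subset_iff (H : IsHubColoring c h) {t : ℕ} (ht : 3 ≤ t)
    (htn : t ≤ Fintype.card V) (C : Finset V) :
    (∃ M ∈ cofacets c h (t + 1), M ⊆ C) ↔ ∀ M ∈ cofacets c h t, ¬ C ⊆ M := by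
  constructor
  · rintro ⟨M, hM, hMC⟩ K hK hCK
    have hle := weight_le_weight (c := c) (h := h) (hMC.trans hCK)
    rcases (hMC.trans hCK).eq_or_ssubset with rfl | hss
    · rcases hM with hM | ⟨-, hM⟩ <;> rcases hK with hK | ⟨-, hK⟩ <;> omega
    · rcases hK with hK | ⟨hcore, hK⟩
      · rcases hM with hM | ⟨-, hM⟩ <;> omega
      · have := hcore.weight_add_three_le H hss
        rcases hM with hM | ⟨-, hM⟩ <;> omega
  · intro hC
    refine exists_cofacet_subset H (by omega) C ?_ ?_
    · by_contra hlt
      obtain ⟨M, hM, hsub⟩ := exists_cofacet_superset H htn C (by omega)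
      exact hC M hM hsub
    · rintro ⟨hcore, hw⟩
      exact hC C (Or.inr ⟨hcore, hw⟩) subset_rfl

/-! ### Closing the cycle -/

/-- A set of vertices that is not contained in an edge contains two vertices whose removal leaves
a set with a core. -/
theorem exists_pair_of_not_subset_edge (H : IsHubColoring c h) {F : Finset V}
    (hF : ∀ i x, c x = (!i) → ¬ F ⊆ {h i, x}) :
    ∃ x ∈ F, ∃ y ∈ F, x ≠ y ∧ HasCore c h {x, y}ᶜ := by
  have same : ∀ x ∈ F, ∀ y ∈ F, x ≠ y → c x = c y →
      ∃ x ∈ F, ∃ y ∈ F, x ≠ y ∧ HasCore c h {x, y}ᶜ := by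
    intro x hx y hy hne hxy
    refine ⟨x, hx, y, hy, hne, hasCore_iff.2 (Or.inr ⟨!(c x), fun z hz => ?_⟩)⟩
    rw [Finset.mem_compl, Finset.mem_insert, Finset.mem_singleton]
    rintro (rfl | rfl)
    · cases hc : c z <;> simp [hc] at hz
    · rw [hxy] at hz
      cases hc : c z <;> simp [hc] at hz
  by_cases hhub : ∃ i, h i ∈ F
  · obtain ⟨i, hi⟩ := hhub
    have hex : ∀ x, c x = (!i) → ∃ y ∈ F, y ≠ h i ∧ y ≠ x := by
      intro x hx
      obtain ⟨y, hyF, hy⟩ := Finset.not_subset.1 (hF i x hx)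
      rw [Finset.mem_insert, Finset.mem_singleton, not_or] at hy
      exact ⟨y, hyF, hy⟩
    obtain ⟨y, hyF, hyh, -⟩ := hex _ (H.color_hub _)
    rcases color_eq_or (c := c) i y with hy | hy
    · exact same y hyF _ hi hyh (hy.trans (H.color_hub i).symm)
    · obtain ⟨z, hzF, hzh, hzy⟩ := hex y hy
      rcases color_eq_or (c := c) i z with hz | hz
      · exact same z hzF _ hi hzh (hz.trans (H.color_hub i).symm)
      · exact same z hzF y hyF hzy (hz.trans hy.symm)
  · push Not at hhub
    obtain ⟨x, hx, -⟩ := Finset.not_subset.1 (hF true _ (H.color_hub _))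
    obtain ⟨y, hy, hyx⟩ := Finset.not_subset.1 (hF (!(c x)) x (by simp))
    rw [Finset.mem_insert, Finset.mem_singleton, not_or] at hyx
    refine ⟨x, hx, y, hy, Ne.symm hyx.2, hasCore_iff.2 (Or.inl fun i => ?_)⟩
    rw [Finset.mem_compl, Finset.mem_insert, Finset.mem_singleton]
    rintro (he | he)
    · exact hhub i (he ▸ hx)
    · exact hhub i (he ▸ hy)

theorem not_isCore_univ (H : IsHubColoring c h) : ¬ IsCore c h Finset.univ := by
  rintro (he | ⟨i, he⟩)
  · obtain ⟨x, hx, hxh⟩ := H.exists_ne_hub true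
    obtain ⟨i, rfl⟩ := mem_hubs.1 (he ▸ Finset.mem_univ x)
    rw [H.color_hub] at hx
    exact hxh (hx ▸ rfl)
  · have := mem_colorClass.1 (he ▸ Finset.mem_univ (h (!i)))
    rw [H.color_hub] at this
    cases i <;> simp at this

theorem exists_edgeCompl_subset_iff (H : IsHubColoring c h) (C : Finset V) :
    (∃ M ∈ edgeCompls c h, M ⊆ C) ↔ ∀ M ∈ cofacets c h (Fintype.card V + 1), ¬ C ⊆ M := by
  constructor
  · rintro ⟨_, ⟨i, x, hx, rfl⟩, hsub⟩ M hM hCM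
    have hcard := Finset.card_compl_add_card ({h i, x} : Finset V)
    rw [card_edge H hx] at hcard
    have hnot : ¬ HasCore c h {h i, x}ᶜ :=
      (not_hasCore_iff H).2 ⟨i, x, by simp, hx, by simp⟩
    rcases (hsub.trans hCM).eq_or_ssubset with rfl | hss
    · have : weight c h {h i, x}ᶜ ≤ ({h i, x}ᶜ : Finset V).card + 1 := by
        by_cases hm : Mono c {h i, x}ᶜ
        · rw [weight_of_mono hnot hm]; omega
        · rw [weight_of_not_mono hnot hm]
      rcases hM with hM | ⟨-, hM⟩ <;> omega
    · have h1 := Finset.card_lt_card hss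
      have h2 := Finset.card_compl_add_card M
      have hcore : HasCore c h M := hasCore_of_card_compl_le_one H (by omega)
      rw [cofacets, Set.mem_ofPred_eq, weight_of_hasCore hcore] at hM
      rcases hM with hM | ⟨hM, hw⟩
      · omega
      · have huniv : M = Finset.univ := by
          rw [← Finset.card_eq_iff_eq_univ]; omega
        exact not_isCore_univ H (huniv ▸ hM)
  · intro hC
    by_contra hn
    push Not at hn
    obtain ⟨x, hx, y, hy, hne, hcore⟩ := exists_pair_of_not_subset_edge H (F := Cᶜ) (by
      intro i x hx hsub
      exact hn _ ⟨i, x, hx, rfl⟩ (by simpa using Finset.compl_subset_compl.2 hsub))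
    refine hC _ (Or.inl ?_) (Finset.subset_compl_comm.1 (fun z hz => ?_) : C ⊆ {x, y}ᶜ)
    · have := Finset.card_compl_add_card ({x, y} : Finset V)
      rw [Finset.card_pair hne] at this
      rw [weight_of_hasCore hcore]
      omega
    · rcases Finset.mem_insert.1 hz with rfl | hz
      · exact hx
      · rwa [Finset.mem_singleton.1 hz]

/-! ### The orbit -/

section Orbit

variable (k : Type*) [Field k] {D : VComplex V}

theorem isCofacetFamily_one (H : IsHubColoring c h) (hD : D.IsCofacetFamily (edgeCompls c h)) :
    (VComplex.nf k D).IsCofacetFamily {M | IsCore c h M} :=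
  hD.nf k (isAntichain_isCore H) (exists_core_subset_iff H)

theorem isCofacetFamily_two (H : IsHubColoring c h) (hD : D.IsCofacetFamily (edgeCompls c h)) :
    ((VComplex.nf k)^[2] D).IsCofacetFamily (bicoloredPairs c h) :=
  (isCofacetFamily_one k H hD).nf k isAntichain_bicoloredPairs
    (exists_bicoloredPair_subset_iff H)

theorem isCofacetFamily_iterate (H : IsHubColoring c h)
    (hD : D.IsCofacetFamily (edgeCompls c h)) {t : ℕ} (ht : 3 ≤ t)
    (htn : t ≤ Fintype.card V + 1) :
    ((VComplex.nf k)^[t] D).IsCofacetFamily (cofacets c h t) := by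
  induction t, ht using Nat.le_induction with
  | base =>
    rw [Function.iterate_succ_apply']
    exact (isCofacetFamily_two k H hD).nf k (isAntichain_cofacets H 3)
      (exists_cofacet_three_subset_iff H)
  | succ t ht ih =>
    rw [Function.iterate_succ_apply']
    exact (ih (by omega)).nf k (isAntichain_cofacets H _)
      (exists_cofacet_succ_subset_iff H ht (by omega))

theorem iterate_card_add_two (H : IsHubColoring c h) (hD : D.IsCofacetFamily (edgeCompls c h))
    (hV : 2 ≤ Fintype.card V) : (VComplex.nf k)^[Fintype.card V + 2] D = D := by
  refine VComplex.IsCofacetFamily.eq ?_ hD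
  rw [Function.iterate_succ_apply']
  exact (isCofacetFamily_iterate k H hD (by omega) le_rfl).nf k (isAntichain_edgeCompls H)
    (exists_edgeCompl_subset_iff H)

/-- Two vertices other than the hubs form a face of every iterate strictly between the ends of the
cycle: the complement of the pair contains the hubs, hence has weight `|V|`. -/
theorem pair_mem_iterate (H : IsHubColoring c h) (hD : D.IsCofacetFamily (edgeCompls c h))
    (hV : 5 ≤ Fintype.card V) {t : ℕ} (ht : 1 ≤ t) (htn : t ≤ Fintype.card V + 1) {x y : V}
    (hx : x ∉ hubs h) (hy : y ∉ hubs h) (hne : x ≠ y) : {x, y} ∈ (VComplex.nf k)^[t] D := by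
  have hcard := Finset.card_compl_add_card ({x, y} : Finset V)
  rw [Finset.card_pair hne] at hcard
  have hhub : hubs h ⊆ {x, y}ᶜ := by
    intro z hz
    rw [Finset.mem_compl, Finset.mem_insert, Finset.mem_singleton]
    rintro (rfl | rfl) <;> contradiction
  have hcore : HasCore c h {x, y}ᶜ := ⟨_, Or.inl rfl, hhub⟩
  have hnot : ∀ K, IsCore c h K → ¬ {x, y}ᶜ ⊆ K := by
    intro K hK hsub
    have hss : hubs h ⊂ K := (hhub.trans hsub).ssubset_of_ne fun he => by
      have := Finset.card_le_card hsub
      rw [← he, card_hubs H] at this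
      omega
    exact (hK.of_ssubset H hss).1 (IsCore.hasCore (Or.inl rfl))
  obtain ⟨t, rfl⟩ : ∃ s, t = s + 1 := ⟨t - 1, by omega⟩
  rw [Function.iterate_succ_apply']
  match t with
  | 0 =>
    rw [Function.iterate_zero_apply, hD.mem_nf_iff k]
    rintro _ ⟨i, z, -, rfl⟩ hsub
    have := hsub (hhub (mem_hubs.2 ⟨i, rfl⟩))
    simp at this
  | 1 => exact ((isCofacetFamily_one k H hD).mem_nf_iff k _).2 hnot
  | 2 =>
    refine ((isCofacetFamily_two k H hD).mem_nf_iff k _).2 fun M hM hsub => ?_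
    have := Finset.card_le_card hsub
    rw [card_bicoloredPair hM] at this
    omega
  | t + 3 =>
    refine ((isCofacetFamily_iterate k H hD (by omega) (by omega)).mem_nf_iff k _).2 ?_
    rintro M (hM | ⟨hM, -⟩) hsub
    · have := weight_le_weight (c := c) (h := h) hsub
      rw [weight_of_hasCore hcore] at this
      omega
    · exact hnot M hM hsub

/-- The double star is bipartite. -/
theorem color_ne_of_pair_mem (H : IsHubColoring c h) (hD : D.IsCofacetFamily (edgeCompls c h))
    {x y : V} (hne : x ≠ y) (hxy : {x, y} ∈ D) : c x ≠ c y := by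
  obtain ⟨_, ⟨i, z, hz, rfl⟩, hsub⟩ := (hD.mem_iff _).1 hxy
  rw [Finset.compl_subset_compl] at hsub
  have hx := hsub (Finset.mem_insert_self x {y})
  have hy := hsub (Finset.mem_insert_of_mem (Finset.mem_singleton_self y))
  rw [Finset.mem_insert, Finset.mem_singleton] at hx hy
  have := H.color_hub i
  rcases hx with rfl | rfl <;> rcases hy with rfl | rfl <;> simp_all

theorem not_isom_iterate (H : IsHubColoring c h) (hD : D.IsCofacetFamily (edgeCompls c h))
    (hV : 5 ≤ Fintype.card V) {t : ℕ} (ht : 1 ≤ t) (htn : t ≤ Fintype.card V + 1) :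
    ¬ VComplex.Isom ((VComplex.nf k)^[t] D) D := by
  rintro ⟨π, hπ⟩
  have key : ∀ x y, x ∉ hubs h → y ∉ hubs h → x ≠ y → c (π x) ≠ c (π y) := by
    intro x y hx hy hne
    have := (hπ _).1 (pair_mem_iterate k H hD hV ht htn hx hy hne)
    rw [Finset.map_insert, Finset.map_singleton] at this
    exact color_ne_of_pair_mem H hD (π.injective.ne hne) this
  have hcard : 2 < (hubs h)ᶜ.card := by
    rw [Finset.card_compl, card_hubs H]
    omega
  obtain ⟨x, hx, y, hy, z, hz, hxy, hxz, hyz⟩ := Finset.two_lt_card.1 hcard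
  rw [Finset.mem_compl] at hx hy hz
  have h1 := key x y hx hy hxy
  have h2 := key x z hx hz hxz
  have h3 := key y z hy hz hyz
  cases e1 : c (π x) <;> cases e2 : c (π y) <;> cases e3 : c (π z) <;> simp_all

end Orbit

end HubColoring

/-! ### The double star -/

namespace DoubleStarVertex

variable {p q : ℕ}

/-- The bipartition of the double star. -/
def color : DoubleStarVertex p q → Bool
  | u => true
  | v => false
  | a _ => false
  | b _ => true

/-- The two centres of the double star. -/
def hub : Bool → DoubleStarVertex p q
  | true => u
  | false => v

theorem isHubColoring (hp : 1 ≤ p) (hq : 1 ≤ q) :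
    IsHubColoring (color (p := p) (q := q)) hub where
  color_hub i := by cases i <;> rfl
  exists_ne_hub i := by
    cases i
    · exact ⟨a ⟨0, hp⟩, rfl, by simp [hub]⟩
    · exact ⟨b ⟨0, hq⟩, rfl, by simp [hub]⟩

theorem card_eq (p q : ℕ) : Fintype.card (DoubleStarVertex p q) = p + q + 2 := by
  let e : DoubleStarVertex p q ≃ Bool ⊕ Fin p ⊕ Fin q :=
    { toFun := fun x => match x with
        | u => .inl true
        | v => .inl false
        | a i => .inr (.inl i)
        | b j => .inr (.inr j)
      invFun := fun y => match y with
        | .inl true => u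
        | .inl false => v
        | .inr (.inl i) => a i
        | .inr (.inr j) => b j
      left_inv := by rintro (_ | _ | _ | _) <;> rfl
      right_inv := by rintro ((_ | _) | _ | _) <;> rfl }
  rw [Fintype.card_congr e]
  simp
  omega

theorem mem_ofGraph_doubleStar (F : Finset (DoubleStarVertex p q)) :
    F ∈ VComplex.ofGraph (doubleStar p q) ↔
      ∃ i x, color x = (!i) ∧ F ⊆ {hub i, x} := by
  change (∃ e ∈ (doubleStar p q).edgeSet, ∀ x ∈ F, x ∈ e) ↔ _
  rw [doubleStar, SimpleGraph.edgeSet_fromEdgeSet]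
  constructor
  · rintro ⟨e, ⟨(he | ⟨i, rfl⟩) | ⟨j, rfl⟩, -⟩, hF⟩
    · rw [Set.mem_singleton_iff] at he
      subst he
      exact ⟨true, v, rfl, fun x hx => by simpa [hub] using hF x hx⟩
    · exact ⟨true, a i, rfl, fun x hx => by simpa [hub] using hF x hx⟩
    · exact ⟨false, b j, rfl, fun x hx => by simpa [hub] using hF x hx⟩
  · rintro ⟨i, x, hx, hF⟩
    refine ⟨s(hub i, x), ⟨?_, ?_⟩, fun y hy => by simpa using hF hy⟩
    · cases i <;> cases x <;> simp_all [hub, color]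
    · cases i <;> cases x <;> simp_all [hub, color]

theorem isCofacetFamily (hp : 1 ≤ p) (hq : 1 ≤ q) :
    (VComplex.ofGraph (doubleStar p q)).IsCofacetFamily
      (HubColoring.edgeCompls (color (p := p) (q := q)) hub) := by
  refine ⟨HubColoring.isAntichain_edgeCompls (isHubColoring hp hq), fun F => ?_⟩
  rw [mem_ofGraph_doubleStar]
  constructor
  · rintro ⟨i, x, hx, hF⟩
    exact ⟨_, ⟨i, x, hx, rfl⟩, Finset.compl_subset_compl.2 hF⟩
  · rintro ⟨_, ⟨i, x, hx, rfl⟩, hF⟩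
    exact ⟨i, x, hx, Finset.compl_subset_compl.1 hF⟩

/-- The four vertices of `D_{1,1}` in their order along the path. -/
def pathEquiv : DoubleStarVertex 1 1 ≃ Fin 4 where
  toFun x := match x with
    | a _ => 0
    | u => 1
    | v => 2
    | b _ => 3
  invFun i := match i with
    | 0 => a 0
    | 1 => u
    | 2 => v
    | 3 => b 0
  left_inv := by decide
  right_inv := by decide

/-- The non-edges of the path `a, u, v, b` form the path `v, a, b, u`; this is the map that takes
the second path to the first. -/
def complPathPerm : DoubleStarVertex 1 1 ≃ DoubleStarVertex 1 1 where
  toFun x := match x with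
    | v => a 0
    | a _ => u
    | b _ => v
    | u => b 0
  invFun x := match x with
    | a _ => v
    | u => a 0
    | v => b 0
    | b _ => u
  left_inv := by decide
  right_inv := by decide

theorem isom_nf_one_one (k : Type*) [Field k] :
    VComplex.Isom (VComplex.nf k (VComplex.ofGraph (doubleStar 1 1)))
      (VComplex.ofGraph (doubleStar 1 1)) := by
  have H : IsHubColoring (color (p := 1) (q := 1)) hub := isHubColoring le_rfl le_rfl
  refine ⟨complPathPerm, fun F => ?_⟩
  rw [(HubColoring.isCofacetFamily_one k H (isCofacetFamily le_rfl le_rfl)).mem_iff,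
    mem_ofGraph_doubleStar]
  change HubColoring.HasCore _ _ _ ↔ _
  rw [HubColoring.hasCore_iff]
  revert F
  decide

theorem nonempty_iso_pathGraph : Nonempty (doubleStar 1 1 ≃g SimpleGraph.pathGraph 4) := by
  refine ⟨⟨pathEquiv, fun {x y} => ?_⟩⟩
  rw [SimpleGraph.pathGraph_adj, doubleStar, SimpleGraph.fromEdgeSet_adj]
  rcases x with _ | _ | i | i <;> rcases y with _ | _ | j | j <;>
    simp [pathEquiv, Fin.eq_zero]

end DoubleStarVertex

theorem theorem5p7 (k : Type*) [Field k] (p q : ℕ) (hp : 1 ≤ p) (hq : 1 ≤ q) :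
    ((p, q) = (1, 1) →
      Nonempty (doubleStar p q ≃g SimpleGraph.pathGraph 4) ∧
        VComplex.IsNFNumber k (VComplex.ofGraph (doubleStar p q)) 1) ∧
    ((p, q) ≠ (1, 1) →
      VComplex.IsNFNumber k (VComplex.ofGraph (doubleStar p q)) (p + q + 4)) := by
  constructor
  · intro hpq
    obtain ⟨rfl, rfl⟩ := Prod.mk.inj hpq
    exact ⟨DoubleStarVertex.nonempty_iso_pathGraph, ⟨Nat.one_pos, DoubleStarVertex.isom_nf_one_one k⟩, fun t ht => ht.1⟩
  · intro hpq
    have hcard := DoubleStarVertex.card_eq p q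
    have hV : 5 ≤ Fintype.card (DoubleStarVertex p q) := by
      rw [hcard]
      by_contra hlt
      exact hpq (Prod.ext (by simp only; omega) (by simp only; omega))
    have H := DoubleStarVertex.isHubColoring hp hq
    have hD := DoubleStarVertex.isCofacetFamily hp hq
    rw [show p + q + 4 = Fintype.card (DoubleStarVertex p q) + 2 by omega]
    refine ⟨⟨by omega, ?_⟩, fun t ht => ?_⟩
    · rw [HubColoring.iterate_card_add_two k H hD (by omega)]
      exact ⟨Equiv.refl _, fun F => by simp⟩
    · by_contra hlt
      exact HubColoring.not_isom_iterate k H hD hV ht.1 (by omega) ht.2
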